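/- For $r>1$ and $x\in\mathbb{R}$ write $[x]^{r-1}=|x|^{r-1}\operatorname{sgn}(x)$. Let $1<p,q<\infty$, $\lambda>0$ and $t_0>0$, and let $u$ be a solution of the Navier problem \[ ([u'']^{p-1})''=\lambda\,[u]^{q-1}\quad\text{on } [0,t_0],\qquad u(0)=u(t_0)=u''(0)=u''(t_0)=0, \] that is positive on $(0,t_0)$; here $u$ and $[u'']^{p-1}$ are twice differentiable on $[0,t_0]$ (one-sided at the end points) and the equation holds at every point. Then $u(t)=u(t_0-t)$ for all $t\in[0,t_0]$. Moreover, there is a $2t_0$-periodic function $u_*\in C^1(\mathbb{R})$ with $u_*=u$ on $[0,t_0]$ such that $u_*$ and $[u_*'']^{p-1}$ are twice differentiable on $\mathbb{R}$ and \[ ([u_*''(t)]^{p-1})''=\lambda\,[u_*(t)]^{q-1}\qquad\text{for all } t\in\mathbb{R}. \] -/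

import Mathlib

/-- The signed power `[x]^(r-1) = |x|^(r-1) sgn x` (that is, `|x|^(r-2) x` with value `0` at `0`). -/
noncomputable def signedPower (r x : ℝ) : ℝ := Real.sign x * |x| ^ (r - 1)

/-- `f` is twice differentiable at every point of `S`, with second derivative `g` there.
Derivatives are taken within `S`, so they are one-sided at the end points of a compact interval and
the usual two-sided ones when `S` is the whole line. -/
def HasSecondDerivOn (f g : ℝ → ℝ) (S : Set ℝ) : Prop :=
  ∃ f' : ℝ → ℝ, (∀ t ∈ S, HasDerivWithinAt f (f' t) S t) ∧
    ∀ t ∈ S, HasDerivWithinAt f' (g t) S t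

/-- `u` is twice differentiable on `S` with `u'' = z`, and
`([u'']^(p-1))'' = lam * [u]^(q-1)` holds at every point of `S`. -/
def SolvesEquationOn (p q lam : ℝ) (u z : ℝ → ℝ) (S : Set ℝ) : Prop :=
  HasSecondDerivOn u z S ∧
    HasSecondDerivOn (fun t => signedPower p (z t)) (fun t => lam * signedPower q (u t)) S

/-- `u` solves `([u'']^(p-1))'' = lam * [u]^(q-1)` on `[0, t₀]` with the Navier boundary conditions
`u(0) = u(t₀) = u''(0) = u''(t₀) = 0`. -/
def SolvesNavierProblem (p q lam t₀ : ℝ) (u : ℝ → ℝ) : Prop :=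
  ∃ z : ℝ → ℝ, SolvesEquationOn p q lam u z (Set.Icc 0 t₀) ∧
    u 0 = 0 ∧ u t₀ = 0 ∧ z 0 = 0 ∧ z t₀ = 0

open Set Filter Topology

/-! Write `v = [u'']^(p-1)` and `w = v'`. Since `v'' > 0` inside and `v` vanishes at both ends, `u''
< 0` inside (`z_neg`). Rolle gives a critical point `c` of `u`, and reversing time places it in the
left half. The differences `f(t) = u(c+t) - u(c-t)` and `g(t) = v(c+t) - v(c-t)` form a cooperative
system: `f''` has the sign of `g`, and `g''` that of `f`. If `w c ≠ 0`, both take its strict sign up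
to `t = c` (`pos_of_cooperative`), where one of them contradicts `u(2c) ≥ 0 ≥ v(2c)`. So `w c = 0`
(`w_eq_zero`), and ODE uniqueness makes `u` symmetric about `c` (`reflect_eq`); then `u(2c) = u(0) =
0` forces `2c = t₀`. Symmetry gives `u'(t₀) = -u'(0)` and `w(t₀) = -w(0)`, exactly what is needed
for the `t₀`-antiperiodic extension to solve the equation across the junctions. -/

/-! ### Signed powers -/

lemma signedPower_neg (r x : ℝ) : signedPower r (-x) = -signedPower r x := by
  simp [signedPower, Real.sign_neg]

lemma signedPower_zero (r : ℝ) : signedPower r 0 = 0 := by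
  simp [signedPower]

lemma signedPower_of_pos (r : ℝ) {x : ℝ} (hx : 0 < x) : signedPower r x = x ^ (r - 1) := by
  simp [signedPower, Real.sign_of_pos hx, abs_of_pos hx]

lemma signedPower_pos (r : ℝ) {x : ℝ} (hx : 0 < x) : 0 < signedPower r x := by
  rw [signedPower_of_pos r hx]
  exact Real.rpow_pos_of_pos hx _

lemma signedPower_neg_of_neg (r : ℝ) {x : ℝ} (hx : x < 0) : signedPower r x < 0 := by
  have h := signedPower_pos r (neg_pos.2 hx)
  rw [signedPower_neg] at h
  exact neg_pos.1 h

lemma signedPower_strictMono {r : ℝ} (hr : 1 < r) : StrictMono (signedPower r) := by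
  refine strictMono_of_odd_strictMonoOn_nonneg (signedPower_neg r) fun x hx y hy hxy => ?_
  rcases (show 0 ≤ x from hx).eq_or_lt with rfl | hx0
  · rw [signedPower_zero]
    exact signedPower_pos r hxy
  · rw [signedPower_of_pos r hx0, signedPower_of_pos r (hx0.trans hxy)]
    exact Real.rpow_lt_rpow hx0.le hxy (by linarith)

/-- On negative numbers, `b ↦ -(-b)^(1/(p-1))` inverts the signed power. -/
lemma neg_rpow_signedPower {p x : ℝ} (hp : 1 < p) (hx : x < 0) :
    -(-signedPower p x) ^ (p - 1)⁻¹ = x := by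
  rw [← signedPower_neg, signedPower_of_pos p (neg_pos.2 hx),
    Real.rpow_rpow_inv (neg_pos.2 hx).le (by linarith), neg_neg]

lemma ContDiffAt.locallyLipschitzOn {f : ℝ → ℝ} {s : Set ℝ} (h : ∀ x ∈ s, ContDiffAt ℝ 1 f x) :
    LocallyLipschitzOn s f := fun x hx => by
  obtain ⟨K, t, ht, hK⟩ := (h x hx).exists_lipschitzOnWith
  exact ⟨K, t, mem_nhdsWithin_of_mem_nhds ht, hK⟩

/-- For `1 < q < 2` the signed power is not Lipschitz at `0`; compactness keeps the set away from
it. -/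
lemma exists_lipschitzOnWith_signedPower (q lam : ℝ) {A : Set ℝ} (hA : IsCompact A)
    (hpos : ∀ x ∈ A, 0 < x) : ∃ K, LipschitzOnWith K (fun x => lam * signedPower q x) A := by
  refine (ContDiffAt.locallyLipschitzOn fun x hx => ?_).exists_lipschitzOnWith_of_compact hA
  refine contDiffAt_const.mul
    ((Real.contDiffAt_rpow_const_of_ne (p := q - 1) (hpos x hx).ne').congr_of_eventuallyEq ?_)
  filter_upwards [lt_mem_nhds (hpos x hx)] with y hy using signedPower_of_pos q hy

lemma exists_lipschitzOnWith_neg_rpow (r : ℝ) {B : Set ℝ} (hB : IsCompact B)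
    (hneg : ∀ x ∈ B, x < 0) : ∃ K, LipschitzOnWith K (fun x : ℝ => -(-x) ^ r) B := by
  refine (ContDiffAt.locallyLipschitzOn fun x hx => ?_).exists_lipschitzOnWith_of_compact hB
  exact (contDiffAt_id.neg.rpow_const_of_ne (by simpa using (hneg x hx).ne)).neg

/-! ### Convexity and cooperative systems -/

lemma strictMonoOn_of_hasDerivAt_pos {D : Set ℝ} (hD : Convex ℝ D) {f f' : ℝ → ℝ}
    (hf : ContinuousOn f D) (hf' : ∀ x ∈ interior D, HasDerivAt f (f' x) x)
    (hpos : ∀ x ∈ interior D, 0 < f' x) : StrictMonoOn f D :=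
  strictMonoOn_of_hasDerivWithinAt_pos hD hf (fun x hx => (hf' x hx).hasDerivWithinAt) hpos

/-- Only continuity is asked at `L`: in the application, that end reaches a boundary point, where
derivatives are one-sided. -/
lemma pos_of_second_deriv_pos {f f' f'' : ℝ → ℝ} {L : ℝ}
    (hc : ContinuousOn f (Icc 0 L)) (hf : ∀ t ∈ Ico 0 L, HasDerivAt f (f' t) t)
    (hf' : ∀ t ∈ Ico 0 L, HasDerivAt f' (f'' t) t) (hpos : ∀ t ∈ Ioo 0 L, 0 < f'' t)
    (h0 : f 0 = 0) (h0' : 0 ≤ f' 0) : ∀ t ∈ Ioc 0 L, 0 < f t := by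
  intro t ht
  have hL : 0 < L := ht.1.trans_le ht.2
  have hm' : StrictMonoOn f' (Ico 0 L) := by
    refine strictMonoOn_of_hasDerivAt_pos (convex_Ico 0 L)
      (fun x hx => (hf' x hx).continuousAt.continuousWithinAt) (f' := f'') ?_ ?_ <;>
      rw [interior_Ico]
    · exact fun x hx => hf' x (Ioo_subset_Ico_self hx)
    · exact hpos
  have hm : StrictMonoOn f (Icc 0 L) := by
    refine strictMonoOn_of_hasDerivAt_pos (convex_Icc 0 L) hc (f' := f') ?_ ?_ <;>
      rw [interior_Icc]
    · exact fun x hx => hf x (Ioo_subset_Ico_self hx)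
    · exact fun x hx => h0'.trans_lt (hm' (left_mem_Ico.2 hL) (Ioo_subset_Ico_self hx) hx.1)
  have := hm (left_mem_Icc.2 hL.le) (Ioc_subset_Icc_self ht) ht.1
  rwa [h0] at this

lemma eventually_pos_of_hasDerivAt {g : ℝ → ℝ} {g' : ℝ} (hg : HasDerivAt g g' 0)
    (h0 : g 0 = 0) (hpos : 0 < g') : ∃ ε > 0, ∀ t ∈ Ioo 0 ε, 0 < g t := by
  have h := (hasDerivAt_iff_tendsto_slope.1 hg).eventually (lt_mem_nhds hpos)
  have h2 : ∀ᶠ t in 𝓝[>] (0 : ℝ), 0 < slope g 0 t :=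
    h.filter_mono (nhdsWithin_mono _ fun x hx => ne_of_gt hx)
  obtain ⟨ε, hε, hsub⟩ := (mem_nhdsGT_iff_exists_Ioo_subset).1 h2
  refine ⟨ε, hε, fun t ht => ?_⟩
  have := hsub ht
  simp only [mem_ofPred_eq, slope_def_field, h0, sub_zero] at this
  exact (div_pos_iff_of_pos_right ht.1).1 this

/-- Positivity for a cooperative second-order system: if each component is convex as long as the
other one is positive, then both stay positive. -/
lemma pos_of_cooperative {f f' f'' g g' g'' : ℝ → ℝ} {L : ℝ}
    (hfc : ContinuousOn f (Icc 0 L)) (hf : ∀ t ∈ Ico 0 L, HasDerivAt f (f' t) t)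
    (hf' : ∀ t ∈ Ico 0 L, HasDerivAt f' (f'' t) t)
    (hgc : ContinuousOn g (Icc 0 L)) (hg : ∀ t ∈ Ico 0 L, HasDerivAt g (g' t) t)
    (hg' : ∀ t ∈ Ico 0 L, HasDerivAt g' (g'' t) t)
    (hgf : ∀ t ∈ Ioo 0 L, 0 < g t → 0 < f'' t) (hfg : ∀ t ∈ Ioo 0 L, 0 < f t → 0 < g'' t)
    (hf0 : f 0 = 0) (hf0' : 0 ≤ f' 0) (hg0 : g 0 = 0) (hg0' : 0 < g' 0) :
    ∀ t ∈ Ioc 0 L, 0 < f t ∧ 0 < g t := by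
  -- Positivity of `g` before `T` passes to `f` by convexity, and back to `g` up to and including
  -- `T`.
  have key : ∀ T ∈ Ioc 0 L, (∀ t ∈ Ioo 0 T, 0 < g t) → 0 < f T ∧ 0 < g T := by
    intro T hT hpos
    have hIcc : Icc 0 T ⊆ Icc 0 L := Icc_subset_Icc_right hT.2
    have hIco : Ico 0 T ⊆ Ico 0 L := Ico_subset_Ico_right hT.2
    have hIoo : Ioo 0 T ⊆ Ioo 0 L := Ioo_subset_Ioo_right hT.2
    have h1 : ∀ t ∈ Ioc 0 T, 0 < f t :=
      pos_of_second_deriv_pos (hfc.mono hIcc) (fun t ht => hf t (hIco ht))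
        (fun t ht => hf' t (hIco ht)) (fun t ht => hgf t (hIoo ht) (hpos t ht)) hf0 hf0'
    exact ⟨h1 T (right_mem_Ioc.2 hT.1),
      pos_of_second_deriv_pos (hgc.mono hIcc) (fun t ht => hg t (hIco ht))
        (fun t ht => hg' t (hIco ht)) (fun t ht => hfg t (hIoo ht) (h1 t (Ioo_subset_Ioc_self ht)))
        hg0 hg0'.le T (right_mem_Ioc.2 hT.1)⟩
  intro t ht
  refine key t ht ?_
  by_contra! hcon
  obtain ⟨s, hs, hgs⟩ := hcon
  have hL : 0 < L := ht.1.trans_le ht.2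
  obtain ⟨ε, hε, hεpos⟩ := eventually_pos_of_hasDerivAt (hg 0 (left_mem_Ico.2 hL)) hg0 hg0'
  have hεs : ε ≤ s := by
    by_contra! h
    exact hgs.not_gt (hεpos s ⟨hs.1, h⟩)
  have hsL : s ≤ L := hs.2.le.trans ht.2
  -- `g' 0 > 0` keeps the zero at `0` out of this set, so a first failure time exists; `key` rules
  -- it out.
  have hcomp : IsCompact (Icc ε s ∩ g ⁻¹' Iic 0) := by
    refine isCompact_Icc.of_isClosed_subset ?_ inter_subset_left
    exact (hgc.mono (Icc_subset_Icc hε.le hsL)).preimage_isClosed_of_isClosed isClosed_Icc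
      isClosed_Iic
  obtain ⟨T, hT, hmin⟩ := hcomp.exists_isLeast ⟨s, ⟨hεs, le_rfl⟩, hgs⟩
  have hT0 : 0 < T := hε.trans_le hT.1.1
  refine hT.2.not_gt (key T ⟨hT0, hT.1.2.trans hsL⟩ fun r hr => ?_).2
  by_contra! hgr
  rcases lt_or_ge r ε with h | h
  · exact hgr.not_gt (hεpos r ⟨hr.1, h⟩)
  · exact hr.2.not_ge (hmin ⟨⟨h, hr.2.le.trans hT.1.2⟩, hgr⟩)

/-! ### Uniqueness for the Cauchy problem -/

/-- Uniqueness for the system `f'' = φ(g)`, `g'' = ψ(f)` with Lipschitz nonlinearities. -/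
lemma secondOrderSystem_unique {φ ψ : ℝ → ℝ} {K₁ K₂ : NNReal} {A B : Set ℝ} {d : ℝ}
    (hφ : LipschitzOnWith K₁ φ B) (hψ : LipschitzOnWith K₂ ψ A)
    {f₁ f₁' g₁ g₁' f₂ f₂' g₂ g₂' : ℝ → ℝ}
    (hf₁ : ∀ t ∈ Icc 0 d, HasDerivAt f₁ (f₁' t) t)
    (hf₁' : ∀ t ∈ Icc 0 d, HasDerivAt f₁' (φ (g₁ t)) t)
    (hg₁ : ∀ t ∈ Icc 0 d, HasDerivAt g₁ (g₁' t) t)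
    (hg₁' : ∀ t ∈ Icc 0 d, HasDerivAt g₁' (ψ (f₁ t)) t)
    (hf₂ : ∀ t ∈ Icc 0 d, HasDerivAt f₂ (f₂' t) t)
    (hf₂' : ∀ t ∈ Icc 0 d, HasDerivAt f₂' (φ (g₂ t)) t)
    (hg₂ : ∀ t ∈ Icc 0 d, HasDerivAt g₂ (g₂' t) t)
    (hg₂' : ∀ t ∈ Icc 0 d, HasDerivAt g₂' (ψ (f₂ t)) t)
    (hA₁ : ∀ t ∈ Icc 0 d, f₁ t ∈ A) (hB₁ : ∀ t ∈ Icc 0 d, g₁ t ∈ B)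
    (hA₂ : ∀ t ∈ Icc 0 d, f₂ t ∈ A) (hB₂ : ∀ t ∈ Icc 0 d, g₂ t ∈ B)
    (h1 : f₁ 0 = f₂ 0) (h2 : f₁' 0 = f₂' 0) (h3 : g₁ 0 = g₂ 0) (h4 : g₁' 0 = g₂' 0) :
    EqOn f₁ f₂ (Icc 0 d) := by
  let S : Set (ℝ × ℝ × ℝ × ℝ) := {x | x.1 ∈ A ∧ x.2.2.1 ∈ B}
  let F : ℝ × ℝ × ℝ × ℝ → ℝ × ℝ × ℝ × ℝ := fun x => (x.2.1, φ x.2.2.1, x.2.2.2, ψ x.1)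
  have l1 : LipschitzWith 1 (fun x : ℝ × ℝ × ℝ × ℝ => x.1) := LipschitzWith.prod_fst
  have l2 : LipschitzWith (1 * 1) (fun x : ℝ × ℝ × ℝ × ℝ => x.2.1) :=
    LipschitzWith.prod_fst.comp LipschitzWith.prod_snd
  have l3 : LipschitzWith (1 * (1 * 1)) (fun x : ℝ × ℝ × ℝ × ℝ => x.2.2.1) :=
    LipschitzWith.prod_fst.comp (LipschitzWith.prod_snd.comp LipschitzWith.prod_snd)
  have l4 : LipschitzWith (1 * (1 * 1)) (fun x : ℝ × ℝ × ℝ × ℝ => x.2.2.2) :=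
    LipschitzWith.prod_snd.comp (LipschitzWith.prod_snd.comp LipschitzWith.prod_snd)
  have hF := l2.lipschitzOnWith (s := S) |>.prodMk
    ((hφ.comp (l3.lipschitzOnWith (s := S)) fun x hx => hx.2).prodMk
      ((l4.lipschitzOnWith (s := S)).prodMk
        (hψ.comp (l1.lipschitzOnWith (s := S)) fun x hx => hx.1)))
  have d₁ : ∀ t ∈ Icc 0 d, HasDerivAt (fun t => (f₁ t, f₁' t, g₁ t, g₁' t))
      (F (f₁ t, f₁' t, g₁ t, g₁' t)) t := fun t ht =>
    (hf₁ t ht).prodMk ((hf₁' t ht).prodMk ((hg₁ t ht).prodMk (hg₁' t ht)))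
  have d₂ : ∀ t ∈ Icc 0 d, HasDerivAt (fun t => (f₂ t, f₂' t, g₂ t, g₂' t))
      (F (f₂ t, f₂' t, g₂ t, g₂' t)) t := fun t ht =>
    (hf₂ t ht).prodMk ((hf₂' t ht).prodMk ((hg₂ t ht).prodMk (hg₂' t ht)))
  have := ODE_solution_unique_of_mem_Icc_right (v := fun _ => F) (s := fun _ => S)
    (fun _ _ => hF) (fun t ht => (d₁ t ht).continuousAt.continuousWithinAt)
    (fun t ht => (d₁ t (Ico_subset_Icc_self ht)).hasDerivWithinAt)
    (fun t ht => ⟨hA₁ t (Ico_subset_Icc_self ht), hB₁ t (Ico_subset_Icc_self ht)⟩)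
    (fun t ht => (d₂ t ht).continuousAt.continuousWithinAt)
    (fun t ht => (d₂ t (Ico_subset_Icc_self ht)).hasDerivWithinAt)
    (fun t ht => ⟨hA₂ t (Ico_subset_Icc_self ht), hB₂ t (Ico_subset_Icc_self ht)⟩)
    (by simp [h1, h2, h3, h4])
  exact fun t ht => congrArg Prod.fst (this ht)

/-! ### Symmetry of positive solutions -/

/-- A positive solution of the Navier problem, with all its derivatives named:
`u'' = z` and `([z]^(p-1))' = w`. -/
structure IsPositiveNavierSolution (p q lam T : ℝ) (u u' z w : ℝ → ℝ) : Prop where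
  deriv_u : ∀ t ∈ Icc 0 T, HasDerivWithinAt u (u' t) (Icc 0 T) t
  deriv_u' : ∀ t ∈ Icc 0 T, HasDerivWithinAt u' (z t) (Icc 0 T) t
  deriv_v : ∀ t ∈ Icc 0 T, HasDerivWithinAt (fun t => signedPower p (z t)) (w t) (Icc 0 T) t
  deriv_w : ∀ t ∈ Icc 0 T, HasDerivWithinAt w (lam * signedPower q (u t)) (Icc 0 T) t
  u_zero : u 0 = 0
  u_end : u T = 0
  z_zero : z 0 = 0
  z_end : z T = 0
  u_pos : ∀ t ∈ Ioo 0 T, 0 < u t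

lemma HasDerivWithinAt.comp_const_sub_Icc {f : ℝ → ℝ} {f' T t : ℝ} (ht : t ∈ Icc 0 T)
    (h : ∀ s ∈ Icc 0 T, s = T - t → HasDerivWithinAt f f' (Icc 0 T) s) :
    HasDerivWithinAt (fun s => f (T - s)) (-f') (Icc 0 T) t := by
  have hm : ∀ s ∈ Icc 0 T, T - s ∈ Icc 0 T := fun s hs => ⟨by linarith [hs.2], by linarith [hs.1]⟩
  have h2 := (h (T - t) (hm t ht) rfl).comp t
    (((hasDerivAt_id t).const_sub T).hasDerivWithinAt (s := Icc 0 T)) hm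
  simpa [Function.comp_def] using h2

namespace IsPositiveNavierSolution

variable {p q lam T : ℝ} {u u' z w : ℝ → ℝ}

lemma reverse (h : IsPositiveNavierSolution p q lam T u u' z w) :
    IsPositiveNavierSolution p q lam T (fun t => u (T - t)) (fun t => -u' (T - t))
      (fun t => z (T - t)) (fun t => -w (T - t)) where
  deriv_u t ht := .comp_const_sub_Icc ht (by rintro s hs rfl; exact h.deriv_u _ hs)
  deriv_u' t ht := by
    simpa using (HasDerivWithinAt.comp_const_sub_Icc ht
      (by rintro s hs rfl; exact h.deriv_u' _ hs)).fun_neg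
  deriv_v t ht := .comp_const_sub_Icc (f := fun t => signedPower p (z t)) ht
    (by rintro s hs rfl; exact h.deriv_v _ hs)
  deriv_w t ht := by
    simpa using (HasDerivWithinAt.comp_const_sub_Icc ht
      (by rintro s hs rfl; exact h.deriv_w _ hs)).fun_neg
  u_zero := by simpa using h.u_end
  u_end := by simpa using h.u_zero
  z_zero := by simpa using h.z_end
  z_end := by simpa using h.z_zero
  u_pos t ht := h.u_pos _ ⟨by linarith [ht.2], by linarith [ht.1]⟩

/-- If `z x ≥ 0`, the mean slope of `[z]^(p-1)` is nonnegative on `[0, x]` and nonpositive on `[x,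
T]`, against strict monotonicity of `w`. -/
lemma z_neg (h : IsPositiveNavierSolution p q lam T u u' z w) (hp : 1 < p) (hlam : 0 < lam) :
    ∀ t ∈ Ioo 0 T, z t < 0 := by
  intro x hx
  have hm : StrictMonoOn w (Icc 0 T) := by
    refine strictMonoOn_of_hasDerivAt_pos (convex_Icc 0 T)
      (fun t ht => (h.deriv_w t ht).continuousWithinAt)
      (f' := fun t => lam * signedPower q (u t)) ?_ ?_ <;> rw [interior_Icc] <;> intro t ht
    · exact (h.deriv_w t (Ioo_subset_Icc_self ht)).hasDerivAt (Icc_mem_nhds ht.1 ht.2)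
    · exact mul_pos hlam (signedPower_pos q (h.u_pos t ht))
  have hc : ContinuousOn (fun t => signedPower p (z t)) (Icc 0 T) :=
    fun t ht => (h.deriv_v t ht).continuousWithinAt
  have hd : ∀ t ∈ Ioo 0 T, HasDerivAt (fun t => signedPower p (z t)) (w t) t := fun t ht =>
    (h.deriv_v t (Ioo_subset_Icc_self ht)).hasDerivAt (Icc_mem_nhds ht.1 ht.2)
  obtain ⟨a, ha, hwa⟩ := exists_hasDerivAt_eq_slope _ w hx.1
    (hc.mono (Icc_subset_Icc_right hx.2.le)) fun t ht => hd t ⟨ht.1, ht.2.trans hx.2⟩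
  obtain ⟨b, hb, hwb⟩ := exists_hasDerivAt_eq_slope _ w hx.2
    (hc.mono (Icc_subset_Icc_left hx.1.le)) fun t ht => hd t ⟨hx.1.trans ht.1, ht.2⟩
  have hab : w a < w b := hm ⟨ha.1.le, (ha.2.trans hx.2).le⟩ ⟨(hx.1.trans hb.1).le, hb.2.le⟩
    (ha.2.trans hb.1)
  by_contra! hz
  have hv : 0 ≤ signedPower p (z x) := by
    simpa [signedPower_zero] using (signedPower_strictMono hp).monotone hz
  simp only [h.z_zero, h.z_end, signedPower_zero] at hwa hwb
  have h1 : 0 ≤ w a := hwa ▸ div_nonneg (by linarith) (by linarith [hx.1])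
  have h2 : w b ≤ 0 := hwb ▸ div_nonpos_of_nonpos_of_nonneg (by linarith) (by linarith [hx.2])
  linarith

/-- The comparison of a solution with its reflection about a critical point `c` of `u` in the left
half of the interval shows that `c` is also critical for `[u'']^(p-1)`. -/
lemma w_eq_zero (h : IsPositiveNavierSolution p q lam T u u' z w) (hp : 1 < p) (hq : 1 < q)
    (hlam : 0 < lam) {c : ℝ} (hc : 0 < c) (hcT : 2 * c ≤ T) (huc : u' c = 0) : w c = 0 := by
  have dsub : ∀ {f f' : ℝ → ℝ}, (∀ t ∈ Icc 0 T, HasDerivWithinAt f (f' t) (Icc 0 T) t) →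
      ∀ t ∈ Ico 0 c, HasDerivAt f (f' (c + t)) (c + t) ∧ HasDerivAt f (f' (c - t)) (c - t) := by
    intro f f' hf t ht
    exact ⟨(hf _ ⟨by linarith [ht.1], by linarith [ht.2]⟩).hasDerivAt
        (Icc_mem_nhds (by linarith [ht.1]) (by linarith [ht.2])),
      (hf _ ⟨by linarith [ht.2], by linarith [ht.1]⟩).hasDerivAt
        (Icc_mem_nhds (by linarith [ht.2]) (by linarith [ht.1]))⟩
  have dodd : ∀ {f f' : ℝ → ℝ}, (∀ t ∈ Icc 0 T, HasDerivWithinAt f (f' t) (Icc 0 T) t) →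
      ∀ t ∈ Ico 0 c, HasDerivAt (fun t => f (c + t) - f (c - t)) (f' (c + t) + f' (c - t)) t := by
    intro f f' hf t ht
    have := ((dsub hf t ht).1.comp_const_add c t).fun_sub ((dsub hf t ht).2.comp_const_sub c t)
    simpa using this
  have deven : ∀ {f f' : ℝ → ℝ}, (∀ t ∈ Icc 0 T, HasDerivWithinAt f (f' t) (Icc 0 T) t) →
      ∀ t ∈ Ico 0 c, HasDerivAt (fun t => f (c + t) + f (c - t)) (f' (c + t) - f' (c - t)) t := by
    intro f f' hf t ht
    have := ((dsub hf t ht).1.comp_const_add c t).fun_add ((dsub hf t ht).2.comp_const_sub c t)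
    simpa [sub_eq_add_neg] using this
  have cont : ∀ {f f' : ℝ → ℝ}, (∀ t ∈ Icc 0 T, HasDerivWithinAt f (f' t) (Icc 0 T) t) →
      ContinuousOn (fun t => f (c + t) - f (c - t)) (Icc 0 c) := by
    intro f f' hf
    have hfc : ContinuousOn f (Icc 0 T) := fun t ht => (hf t ht).continuousWithinAt
    refine (hfc.comp (by fun_prop) fun t ht => ?_).sub (hfc.comp (by fun_prop) fun t ht => ?_)
    · exact ⟨by linarith [ht.1], by linarith [ht.2]⟩
    · exact ⟨by linarith [ht.2], by linarith [ht.1]⟩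
  have hcc : c ∈ Ioc 0 c := right_mem_Ioc.2 hc
  have hu2c : 0 ≤ u (c + c) := by
    rcases hcT.eq_or_lt with h' | h'
    · rw [← two_mul, h', h.u_end]
    · exact (h.u_pos _ ⟨by linarith, by linarith⟩).le
  have hz2c : z (c + c) ≤ 0 := by
    rcases hcT.eq_or_lt with h' | h'
    · rw [← two_mul, h', h.z_end]
    · exact (h.z_neg hp hlam _ ⟨by linarith, by linarith⟩).le
  -- If `w c < 0`, the negated differences are positive and `u(2c) < u(0) = 0`; if `w c > 0`, then
  -- `v(2c) > v(0) = 0`.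
  rcases lt_trichotomy (w c) 0 with hw | hw | hw
  · exfalso
    have := (pos_of_cooperative (L := c) (cont h.deriv_u).neg (fun t ht => (dodd h.deriv_u t ht).neg)
      (fun t ht => (deven h.deriv_u' t ht).neg) (cont h.deriv_v).neg
      (fun t ht => (dodd h.deriv_v t ht).neg) (fun t ht => (deven h.deriv_w t ht).neg)
      (fun t _ hg => ?_) (fun t _ hf => ?_) (by simp) (by simp [huc]) (by simp)
      (by simp only [add_zero, sub_zero]; linarith) c hcc).1
    · simp only [Pi.neg_apply, sub_self, h.u_zero] at this
      linarith
    · have := (signedPower_strictMono hp).lt_iff_lt.1 (sub_neg.1 (neg_pos.1 hg))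
      linarith
    · have := mul_lt_mul_of_pos_left
        (signedPower_strictMono hq (sub_neg.1 (neg_pos.1 hf))) hlam
      linarith
  · exact hw
  · exfalso
    have := (pos_of_cooperative (L := c) (cont h.deriv_u) (dodd h.deriv_u)
      (deven h.deriv_u') (cont h.deriv_v) (dodd h.deriv_v) (deven h.deriv_w)
      (fun t _ hg => ?_) (fun t _ hf => ?_) (by simp) (by simp [huc]) (by simp)
      (by simp only [add_zero, sub_zero]; linarith) c hcc).2
    · simp only [sub_self, h.z_zero, signedPower_zero, sub_zero] at this
      have h2 := (signedPower_strictMono hp).monotone hz2c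
      rw [signedPower_zero] at h2
      linarith
    · exact sub_pos.2 ((signedPower_strictMono hp).lt_iff_lt.1 (sub_pos.1 hg))
    · exact sub_pos.2 (mul_lt_mul_of_pos_left (signedPower_strictMono hq (sub_pos.1 hf)) hlam)

/-- With `u' c = w c = 0`, both branches have the same Cauchy data at `c`. Taking `d < c` keeps them
in a compact part of `(0, T)`, where `u > 0`, `v < 0` and the nonlinearities are Lipschitz. -/
lemma reflect_eq (h : IsPositiveNavierSolution p q lam T u u' z w) (hp : 1 < p)
    (hlam : 0 < lam) {c : ℝ} (hcT : 2 * c ≤ T) (huc : u' c = 0) (hwc : w c = 0)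
    {d : ℝ} (hd : d ∈ Ico 0 c) : u (c + d) = u (c - d) := by
  have hsub : Icc (c - d) (c + d) ⊆ Ioo 0 T := fun t ht =>
    ⟨by linarith [hd.2, ht.1], by linarith [hd.2, ht.2]⟩
  have dI : ∀ {f f' : ℝ → ℝ}, (∀ t ∈ Icc 0 T, HasDerivWithinAt f (f' t) (Icc 0 T) t) →
      ∀ t ∈ Icc (c - d) (c + d), HasDerivAt f (f' t) t := fun hf t ht =>
    (hf t (Ioo_subset_Icc_self (hsub ht))).hasDerivAt (Icc_mem_nhds (hsub ht).1 (hsub ht).2)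
  have hadd : ∀ t ∈ Icc 0 d, c + t ∈ Icc (c - d) (c + d) := fun t ht =>
    ⟨by linarith [ht.1, ht.2], by linarith [ht.2]⟩
  have hsubm : ∀ t ∈ Icc 0 d, c - t ∈ Icc (c - d) (c + d) := fun t ht =>
    ⟨by linarith [ht.2], by linarith [ht.1, ht.2]⟩
  have hv : ∀ t ∈ Icc (c - d) (c + d), signedPower p (z t) < 0 := fun t ht =>
    signedPower_neg_of_neg p (h.z_neg hp hlam t (hsub ht))
  obtain ⟨K₂, hψ⟩ := exists_lipschitzOnWith_signedPower q lam (A := u '' Icc (c - d) (c + d))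
    (isCompact_Icc.image_of_continuousOn
      fun t ht => (dI h.deriv_u t ht).continuousAt.continuousWithinAt)
    (by rintro _ ⟨t, ht, rfl⟩; exact h.u_pos t (hsub ht))
  obtain ⟨K₁, hφ⟩ := exists_lipschitzOnWith_neg_rpow (p - 1)⁻¹
    (B := (fun t => signedPower p (z t)) '' Icc (c - d) (c + d))
    (isCompact_Icc.image_of_continuousOn
      fun t ht => (dI h.deriv_v t ht).continuousAt.continuousWithinAt)
    (by rintro _ ⟨t, ht, rfl⟩; exact hv t ht)
  have hz : ∀ t ∈ Icc (c - d) (c + d), -(-signedPower p (z t)) ^ (p - 1)⁻¹ = z t := fun t ht =>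
    neg_rpow_signedPower hp (h.z_neg hp hlam t (hsub ht))
  refine secondOrderSystem_unique hφ hψ
    (f₁ := fun t => u (c + t)) (f₁' := fun t => u' (c + t))
    (g₁ := fun t => signedPower p (z (c + t))) (g₁' := fun t => w (c + t))
    (f₂ := fun t => u (c - t)) (f₂' := fun t => -u' (c - t))
    (g₂ := fun t => signedPower p (z (c - t))) (g₂' := fun t => -w (c - t))
    (fun t ht => (dI h.deriv_u _ (hadd t ht)).comp_const_add c t)
    (fun t ht => ?_)
    (fun t ht => (dI h.deriv_v _ (hadd t ht)).comp_const_add c t)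
    (fun t ht => (dI h.deriv_w _ (hadd t ht)).comp_const_add c t)
    (fun t ht => (dI h.deriv_u _ (hsubm t ht)).comp_const_sub c t)
    (fun t ht => ?_)
    (fun t ht => (dI h.deriv_v _ (hsubm t ht)).comp_const_sub c t)
    (fun t ht => ?_)
    (fun t ht => mem_image_of_mem _ (hadd t ht))
    (fun t ht => mem_image_of_mem (fun t => signedPower p (z t)) (hadd t ht))
    (fun t ht => mem_image_of_mem _ (hsubm t ht))
    (fun t ht => mem_image_of_mem (fun t => signedPower p (z t)) (hsubm t ht))
    (by simp) (by simp [huc]) (by simp) (by simp [hwc]) (right_mem_Icc.2 hd.1)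
  · simp only [hz _ (hadd t ht)]
    exact (dI h.deriv_u' _ (hadd t ht)).comp_const_add c t
  · simp only [hz _ (hsubm t ht)]
    simpa using ((dI h.deriv_u' _ (hsubm t ht)).comp_const_sub c t).fun_neg
  · simpa using ((dI h.deriv_w _ (hsubm t ht)).comp_const_sub c t).fun_neg

lemma symmetric_of_critical_le (h : IsPositiveNavierSolution p q lam T u u' z w) (hp : 1 < p)
    (hq : 1 < q) (hlam : 0 < lam) {c : ℝ} (hc : 0 < c) (hcT : 2 * c ≤ T) (huc : u' c = 0) :
    ∀ t ∈ Icc 0 T, u t = u (T - t) := by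
  have hwc := h.w_eq_zero hp hq hlam hc hcT huc
  have huC : ContinuousOn u (Icc 0 T) := fun t ht => (h.deriv_u t ht).continuousWithinAt
  have heq : EqOn (fun t => u (c + t)) (fun t => u (c - t)) (Icc 0 c) := by
    refine EqOn.of_subset_closure (s := Ico 0 c)
      (fun d hd => h.reflect_eq hp hlam hcT huc hwc hd) ?_ ?_ Ico_subset_Icc_self
      (closure_Ico hc.ne).ge
    · exact huC.comp (by fun_prop) fun t ht => ⟨by linarith [ht.1], by linarith [ht.2]⟩
    · exact huC.comp (by fun_prop) fun t ht => ⟨by linarith [ht.2], by linarith [ht.1]⟩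
  -- The symmetry extends by continuity to `u(2c) = u(0) = 0`, impossible at an interior point.
  have hT : 2 * c = T := by
    refine hcT.antisymm (not_lt.1 fun hlt => ?_)
    have h1 : u (c + c) = u (c - c) := heq (right_mem_Icc.2 hc.le)
    rw [sub_self, h.u_zero] at h1
    exact (h.u_pos (c + c) ⟨by linarith, by linarith⟩).ne' h1
  subst hT
  intro t ht
  rcases le_total t c with htc | htc
  · have h1 : u (c + (c - t)) = u (c - (c - t)) := heq ⟨by linarith, by linarith [ht.1]⟩
    rw [show 2 * c - t = c + (c - t) by ring, h1, sub_sub_cancel]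
  · have h1 : u (c + (t - c)) = u (c - (t - c)) := heq ⟨by linarith, by linarith [ht.2]⟩
    rw [show 2 * c - t = c - (t - c) by ring, ← h1, add_sub_cancel]

lemma symmetric (h : IsPositiveNavierSolution p q lam T u u' z w) (hp : 1 < p)
    (hq : 1 < q) (hlam : 0 < lam) (hT : 0 < T) : ∀ t ∈ Icc 0 T, u t = u (T - t) := by
  obtain ⟨c, hc, huc⟩ := exists_hasDerivAt_eq_zero (f' := u') hT
    (fun t ht => (h.deriv_u t ht).continuousWithinAt) (h.u_zero.trans h.u_end.symm)
    fun t ht => (h.deriv_u t (Ioo_subset_Icc_self ht)).hasDerivAt (Icc_mem_nhds ht.1 ht.2)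
  rcases le_total (2 * c) T with hcT | hcT
  · exact h.symmetric_of_critical_le hp hq hlam hc.1 hcT huc
  · intro t ht
    have := h.reverse.symmetric_of_critical_le hp hq hlam (c := T - c) (sub_pos.2 hc.2)
      (by linarith) (by simp [huc]) t ht
    simpa using this.symm

end IsPositiveNavierSolution

/-! ### Antiperiodic extension -/

lemma deriv_reflect_of_symmetric {f f' : ℝ → ℝ} {T : ℝ} (hT : 0 < T)
    (hf : ∀ t ∈ Icc 0 T, HasDerivWithinAt f (f' t) (Icc 0 T) t)
    {ε : ℝ} (hs : ∀ t ∈ Icc 0 T, f t = ε * f (T - t)) :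
    ∀ t ∈ Icc 0 T, f' t = -ε * f' (T - t) := by
  intro t ht
  have h1 := HasDerivWithinAt.comp_const_sub_Icc (f := f) (f' := f' (T - t)) ht
    (by rintro s hs rfl; exact hf _ hs)
  have h2 : HasDerivWithinAt f (ε * -f' (T - t)) (Icc 0 T) t :=
    (h1.const_mul ε).congr hs (hs t ht)
  rw [(uniqueDiffOn_Icc hT t ht).eq_deriv _ (hf t ht) h2]
  ring

/-- The extension of `f` from `[0, T)` to the line with `f (t + T) = -f t`. -/
noncomputable def antiperiodicExtension (T : ℝ) (f : ℝ → ℝ) (t : ℝ) : ℝ :=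
  (-1) ^ ⌊t / T⌋ * f (t - ⌊t / T⌋ * T)

section antiperiodicExtension

variable {T : ℝ} {f f' : ℝ → ℝ}

lemma antiperiodicExtension_eq (hT : 0 < T) (hf : f T = -f 0) (k : ℤ) {t : ℝ}
    (ht : t ∈ Icc (k * T) ((k + 1) * T)) :
    antiperiodicExtension T f t = (-1) ^ k * f (t - k * T) := by
  -- At the right end of the cell the floor is already `k + 1`; `f T = -f 0` reconciles the two
  -- formulas.
  rcases ht.2.eq_or_lt with h | h
  · have hfl : ⌊t / T⌋ = k + 1 := by
      rw [h, mul_div_cancel_right₀ _ hT.ne']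
      exact_mod_cast Int.floor_intCast (k + 1)
    have h1 : t - k * T = T := by rw [h]; ring
    rw [antiperiodicExtension, hfl, h1, hf, zpow_add_one₀ (by norm_num)]
    push_cast
    rw [h, sub_self]
    ring
  · have hfl : ⌊t / T⌋ = k := by
      rw [Int.floor_eq_iff, le_div_iff₀ hT, div_lt_iff₀ hT]
      exact ⟨ht.1, h⟩
    rw [antiperiodicExtension, hfl]

lemma antiperiodicExtension_eqOn (hT : 0 < T) (hf : f T = -f 0) :
    EqOn (antiperiodicExtension T f) f (Icc 0 T) := fun t ht => by
  simpa using antiperiodicExtension_eq hT hf 0 (by simpa using ht)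

lemma antiperiodicExtension_antiperiodic (hT : 0 < T) :
    Function.Antiperiodic (antiperiodicExtension T f) T := fun t => by
  have hfl : ⌊(t + T) / T⌋ = ⌊t / T⌋ + 1 := by
    rw [add_div, div_self hT.ne', Int.floor_add_one]
  rw [antiperiodicExtension, hfl, zpow_add_one₀ (by norm_num), antiperiodicExtension]
  push_cast
  rw [show t + T - (⌊t / T⌋ + 1) * T = t - ⌊t / T⌋ * T by ring]
  ring

lemma map_antiperiodicExtension {g : ℝ → ℝ} (hg : ∀ x, g (-x) = -g x) (t : ℝ) :
    g (antiperiodicExtension T f t) = antiperiodicExtension T (fun s => g (f s)) t := by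
  unfold antiperiodicExtension
  rcases Int.even_or_odd ⌊t / T⌋ with h | h
  · simp [h.neg_one_zpow]
  · simp [h.neg_one_zpow, hg]

lemma hasDerivWithinAt_antiperiodicExtension (hT : 0 < T)
    (hd : ∀ t ∈ Icc 0 T, HasDerivWithinAt f (f' t) (Icc 0 T) t)
    (hf : f T = -f 0) (hf' : f' T = -f' 0) (k : ℤ) {t : ℝ}
    (ht : t ∈ Icc (k * T) ((k + 1) * T)) :
    HasDerivWithinAt (antiperiodicExtension T f) (antiperiodicExtension T f' t)
      (Icc (k * T) ((k + 1) * T)) t := by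
  have hm : ∀ s ∈ Icc (k * T) ((k + 1) * T), s - k * T ∈ Icc 0 T := fun s hs =>
    ⟨by linarith [hs.1], by linarith [hs.2]⟩
  rw [antiperiodicExtension_eq hT hf' k ht]
  refine HasDerivWithinAt.congr ?_ (fun s hs => antiperiodicExtension_eq hT hf k hs)
    (antiperiodicExtension_eq hT hf k ht)
  have h2 := (hd _ (hm t ht)).comp t
    (((hasDerivAt_id t).sub_const (k * T)).hasDerivWithinAt (s := Icc (k * T) ((k + 1) * T))) hm
  simpa [Function.comp_def] using h2.const_mul ((-1 : ℝ) ^ k)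

lemma hasDerivAt_antiperiodicExtension (hT : 0 < T)
    (hd : ∀ t ∈ Icc 0 T, HasDerivWithinAt f (f' t) (Icc 0 T) t)
    (hf : f T = -f 0) (hf' : f' T = -f' 0) (t : ℝ) :
    HasDerivAt (antiperiodicExtension T f) (antiperiodicExtension T f' t) t := by
  have h1 : (⌊t / T⌋ : ℝ) * T ≤ t := (le_div_iff₀ hT).1 (Int.floor_le _)
  have h2 : t < (⌊t / T⌋ + 1) * T := (div_lt_iff₀ hT).1 (Int.lt_floor_add_one _)
  have hr := hasDerivWithinAt_antiperiodicExtension hT hd hf hf' ⌊t / T⌋ ⟨h1, h2.le⟩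
  -- At a multiple of `T`, the one-sided derivatives from the two adjacent cells are glued.
  rcases h1.eq_or_lt with h | h
  · have hl := hasDerivWithinAt_antiperiodicExtension hT hd hf hf' (⌊t / T⌋ - 1) (t := t)
      ⟨by push_cast; linarith, by push_cast; linarith⟩
    have hle : ((⌊t / T⌋ - 1 : ℤ) : ℝ) * T ≤ ((⌊t / T⌋ - 1 : ℤ) + 1) * T := by linarith
    have he : (((⌊t / T⌋ - 1 : ℤ) : ℝ) + 1) * T = ⌊t / T⌋ * T := by push_cast; ring
    refine (hl.union hr).hasDerivAt ?_
    rw [he] at hle ⊢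
    rw [Icc_union_Icc_eq_Icc hle (h1.trans h2.le)]
    exact Icc_mem_nhds (by push_cast; linarith) h2
  · exact hr.hasDerivAt (Icc_mem_nhds h h2)

end antiperiodicExtension

theorem mainTheorem2 (p q lam t₀ : ℝ) (hp : 1 < p) (hq : 1 < q) (hlam : 0 < lam) (ht₀ : 0 < t₀)
    (u : ℝ → ℝ) (hu : SolvesNavierProblem p q lam t₀ u)
    (hpos : ∀ t ∈ Set.Ioo 0 t₀, 0 < u t) :
    (∀ t ∈ Set.Icc 0 t₀, u t = u (t₀ - t)) ∧
      ∃ uStar : ℝ → ℝ,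
        Set.EqOn uStar u (Set.Icc 0 t₀) ∧
        Function.Periodic uStar (2 * t₀) ∧
        ContDiff ℝ 1 uStar ∧
        ∃ z : ℝ → ℝ, SolvesEquationOn p q lam uStar z Set.univ := by
  obtain ⟨z, ⟨⟨u', hdu, hdu'⟩, w, hdv, hdw⟩, hu0, huT, hz0, hzT⟩ := hu
  have h : IsPositiveNavierSolution p q lam t₀ u u' z w :=
    ⟨hdu, hdu', hdv, hdw, hu0, huT, hz0, hzT, hpos⟩
  have hs := h.symmetric hp hq hlam ht₀
  -- Each differentiation flips the parity: `u`, `z` and `v` are even about the midpoint, `u'` and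
  -- `w` odd.
  have hs' := deriv_reflect_of_symmetric ht₀ hdu (ε := 1) (by simpa using hs)
  have hsz := deriv_reflect_of_symmetric ht₀ hdu' hs'
  have hsw := deriv_reflect_of_symmetric ht₀ hdv (ε := 1) fun t ht => by
    have := hsz t ht
    simp only [neg_neg, one_mul] at this ⊢
    rw [this]
  have hTT : t₀ ∈ Icc 0 t₀ := right_mem_Icc.2 ht₀.le
  have du := hasDerivAt_antiperiodicExtension ht₀ hdu (by simp [hu0, huT])
    (by simpa using hs' t₀ hTT)
  have du' := hasDerivAt_antiperiodicExtension ht₀ hdu' (by simpa using hs' t₀ hTT)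
    (by simp [hz0, hzT])
  have dv := hasDerivAt_antiperiodicExtension ht₀ hdv (by simp [hz0, hzT, signedPower_zero])
    (by simpa using hsw t₀ hTT)
  have dw := hasDerivAt_antiperiodicExtension ht₀ hdw (by simpa using hsw t₀ hTT)
    (by simp [hu0, huT, signedPower_zero])
  refine ⟨hs, antiperiodicExtension t₀ u, antiperiodicExtension_eqOn ht₀ (by simp [hu0, huT]),
    (antiperiodicExtension_antiperiodic ht₀).periodic_two_mul, ?_,
    antiperiodicExtension t₀ z, ⟨antiperiodicExtension t₀ u', ?_, ?_⟩,
    antiperiodicExtension t₀ w, ?_, ?_⟩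
  · refine contDiff_one_iff_deriv.2 ⟨fun t => (du t).differentiableAt, ?_⟩
    rw [show deriv (antiperiodicExtension t₀ u) = antiperiodicExtension t₀ u' from
      funext fun t => (du t).deriv]
    exact continuous_iff_continuousAt.2 fun t => (du' t).continuousAt
  · exact fun t _ => (du t).hasDerivWithinAt
  · exact fun t _ => (du' t).hasDerivWithinAt
  · simp only [map_antiperiodicExtension (signedPower_neg p)]
    exact fun t _ => (dv t).hasDerivWithinAt
  · intro t _
    beta_reduce
    rw [map_antiperiodicExtension (g := fun x => lam * signedPower q x)
      (fun x => by rw [signedPower_neg, mul_neg])]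
    exact (dw t).hasDerivWithinAt
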